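/- **Proposition 2 (Shift-invariant square-root kernels).** Call $\mathbf{k}:\mathbb{R}^d\times\mathbb{R}^d\to\mathbb{R}$ a *reproducing kernel* if all matrices $(\mathbf{k}(z_i,z_j))_{i,j=1}^{l}$ with $z_1,\dots,z_l\in\mathbb{R}^d$ are symmetric and positive semidefinite. For $f\in L^1(\mathbb{R}^d;\mathbb{C})$ let $$\mathcal{F}(f)(\omega)=\frac{1}{(2\pi)^{d/2}}\int_{\mathbb{R}^d} f(x)\,e^{-i\langle x,\omega\rangle}\,dx .$$ A measurable function $\widehat\kappa:\mathbb{R}^d\to\mathbb{C}$ in $L^2_{\mathrm{loc}}(\mathbb{R}^d\setminus\{0\})$ is a *generalized Fourier transform of order $m$* ($m\in\mathbb{N}_0$) of a continuous function $\kappa$ of at most polynomial growth if $\widehat\kappa\,\gamma$ is integrable and $\int\kappa(x)\,\mathcal{F}(\gamma)(x)\,dx=\int\widehat\kappa(\omega)\,\gamma(\omega)\,d\omega$ for every Schwartz function $\gamma$ with $\gamma(\omega)=O(\|\omega\|^{2m})$ as $\omega\to0$; for $m=0$ this is every Schwartz function. Let $\mathbf{k}(x,y)=\kappa(x-y)$ be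 a continuous reproducing kernel on $\mathbb{R}^d$ and suppose that $\kappa$ has a generalized Fourier transform $\widehat\kappa$ of order $0$ with $\int_{\mathbb{R}^d}\bigl|\sqrt{\widehat\kappa(\omega)}\bigr|\,d\omega<\infty$ ($\sqrt{\cdot}$ being the principal square root). Then $\widehat\kappa$ is real and nonnegative almost everywhere, and, with $\kappa_{\mathrm{rt}}=\mathcal{F}\bigl(\sqrt{\widehat\kappa}\bigr)$, the function $$\mathbf{k}_{\mathrm{rt}}(x,y)=\frac{1}{(2\pi)^{d/4}}\,\kappa_{\mathrm{rt}}(x-y)$$ is a square-root kernel of $\mathbf{k}$: it is a real-valued reproducing kernel and, for all $x,y\in\mathbb{R}^d$, $$\mathbf{k}(x,y)=\int_{\mathbb{R}^d}\mathbf{k}_{\mathrm{rt}}(x,z)\,\mathbf{k}_{\mathrm{rt}}(y,z)\,dz ,$$ with an absolutely convergent integral. -/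

import Mathlib

open MeasureTheory Filter Topology
open scoped SchwartzMap

noncomputable section

/-- A (reproducing) kernel: a real function of two variables all of whose kernel matrices
`(k (z i) (z j))` are symmetric and positive semidefinite. -/
def IsReproducingKernel {E : Type*} (k : E → E → ℝ) : Prop :=
  ∀ (l : ℕ) (z : Fin l → E), (Matrix.of fun i j => k (z i) (z j)).PosSemidef

/-- `r` is a square-root kernel of `k`: it is a reproducing kernel, and
`k x y = ∫ r x z * r y z dz`, the integral being absolutely convergent. -/
def IsSquareRootKernel {d : ℕ} (r k : EuclideanSpace ℝ (Fin d) → EuclideanSpace ℝ (Fin d) → ℝ) :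
    Prop :=
  IsReproducingKernel r ∧
    ∀ x y, Integrable (fun z => r x z * r y z) ∧ k x y = ∫ z, r x z * r y z

/-- The Fourier transform in the unitary angular frequency convention,
`F f ω = (2π)^(-d/2) ∫ f x * exp (-i ⟪x, ω⟫) dx`. -/
def angularFourier {d : ℕ} (f : EuclideanSpace ℝ (Fin d) → ℂ) (ω : EuclideanSpace ℝ (Fin d)) : ℂ :=
  (((2 * Real.pi) ^ (-(d : ℝ) / 2) : ℝ) : ℂ) *
    ∫ x, f x * Complex.exp (-(Complex.I * ((inner ℝ x ω : ℝ) : ℂ)))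

/-- A function of at most polynomial growth at infinity. -/
def IsSlowlyIncreasing {d : ℕ} (f : EuclideanSpace ℝ (Fin d) → ℂ) : Prop :=
  ∃ N : ℕ, f =O[Bornology.cobounded (EuclideanSpace ℝ (Fin d))] fun x => ‖x‖ ^ N

/-- `g` is a generalized Fourier transform, of order `m`, of the continuous slowly increasing
function `f`: `g` is measurable, locally square integrable away from the origin, and
`∫ f * F γ = ∫ g * γ` (the right-hand integral being absolutely convergent) for all Schwartz
functions `γ` with `γ ω = O(‖ω‖ ^ (2 m))` as `ω → 0`. -/
structure IsGeneralizedFourierTransform {d : ℕ} (m : ℕ) (f g : EuclideanSpace ℝ (Fin d) → ℂ) :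
    Prop where
  continuous : Continuous f
  slowlyIncreasing : IsSlowlyIncreasing f
  measurable : Measurable g
  locallySquareIntegrable : ∀ K : Set (EuclideanSpace ℝ (Fin d)), IsCompact K → 0 ∉ K →
    MemLp g 2 (volume.restrict K)
  integrable : ∀ γ : 𝓢(EuclideanSpace ℝ (Fin d), ℂ),
    ((γ : EuclideanSpace ℝ (Fin d) → ℂ) =O[𝓝 0] fun ω => ‖ω‖ ^ (2 * m)) →
    Integrable fun ω => g ω * γ ω
  integral_eq : ∀ γ : 𝓢(EuclideanSpace ℝ (Fin d), ℂ),
    ((γ : EuclideanSpace ℝ (Fin d) → ℂ) =O[𝓝 0] fun ω => ‖ω‖ ^ (2 * m)) →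
    ∫ x, f x * angularFourier γ x = ∫ ω, g ω * γ ω

end

/-! The argument is the hard direction of Bochner's theorem followed by Plancherel. Integrated
positive definiteness gives `∬ κ(x - y) u(x) conj(u(y)) ≥ 0`. For `u = 𝓕 γ` with `γ` real, this says
that the transform of `κ` pairs nonnegatively with `γ²` (`re_integral_mul_sq_nonneg`). Squares
suffice for a.e. nonnegativity of the real part, and evenness of `κ` removes the imaginary part.
Testing against dilated bumps, whose transforms share one L¹ norm, bounds the total mass by a
multiple of `κ 0` (`integrable_of_kernel`), so `κ` is pointwise the Fourier integral of its
transform (`fourier_eq`). Hence `σ = √κhat` is even and lies in L¹ ∩ L². Its transform is a positive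
superposition of characters, hence a kernel, and Plancherel for two modulated copies of `σ` turns
`σ²` into the required convolution (`integral_fourier_sub_mul_fourier_sub`). This is done with
frequencies in `e^{-2πi⟨x, ξ⟩}` and rescaled at the end. -/

/-! ### Positive definiteness in integrated form. -/

theorem measurePreserving_eval_pair {X ι : Type*} [MeasurableSpace X] [Fintype ι] (P : Measure X)
    [IsProbabilityMeasure P] {i j : ι} (hij : i ≠ j) :
    MeasurePreserving (fun z : ι → X => (z i, z j)) (Measure.pi fun _ => P) (P.prod P) := by
  have h := ProbabilityTheory.iIndepFun_pi (μ := fun _ : ι => P) (X := fun _ => id)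
    (fun _ => aemeasurable_id)
  have h2 := (ProbabilityTheory.indepFun_iff_map_prod_eq_prod_map_map
    (measurable_pi_apply i).aemeasurable (measurable_pi_apply j).aemeasurable).1 (h.indepFun hij)
  refine ⟨by fun_prop, ?_⟩
  have e (i : ι) : Measure.map (fun z : ι → X => z i) (Measure.pi fun _ => P) = P :=
    (measurePreserving_eval (fun _ => P) i).map_eq
  rw [e, e] at h2
  exact h2

/-- A bounded function on `X × X` whose double sums over finite samples are nonnegative has a
nonnegative integral against `P × P` (average the double sums over independent samples). -/
theorem integral_prod_nonneg_of_double_sum_nonneg {X : Type*} [MeasurableSpace X] (P : Measure X)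
    [IsProbabilityMeasure P] (H : X × X → ℝ) (hm : Measurable H) (C : ℝ) (hC : ∀ p, |H p| ≤ C)
    (hpos : ∀ (n : ℕ) (z : Fin n → X), 0 ≤ ∑ i, ∑ j, H (z i, z j)) :
    0 ≤ ∫ p, H p ∂(P.prod P) := by
  set A := ∫ p, H p ∂(P.prod P)
  -- The mean double sum has `n` diagonal terms, each at most `C`, and `n (n - 1)` off-diagonal
  -- terms, each equal to `A`; the latter dominate for large `n`.
  have key : ∀ n : ℕ, 0 ≤ (n : ℝ) * (C + ((n : ℝ) - 1) * A) := by
    intro n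
    let Q : Measure (Fin n → X) := Measure.pi fun _ => P
    have hint : ∀ i j, Integrable (fun z : Fin n → X => H (z i, z j)) Q := fun i j =>
      Integrable.of_bound (hm.comp (by fun_prop)).aestronglyMeasurable C
        (Eventually.of_forall fun z => hC _)
    have h0 : 0 ≤ ∫ z, ∑ i, ∑ j, H (z i, z j) ∂Q := integral_nonneg fun z => hpos n z
    rw [integral_finsetSum _ fun i _ => integrable_finsetSum _ fun j _ => hint i j] at h0
    have hi : ∀ i : Fin n, ∫ z, ∑ j, H (z i, z j) ∂Q ≤ C + ((n : ℝ) - 1) * A := by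
      intro i
      rw [integral_finsetSum _ fun j _ => hint i j,
        ← Finset.add_sum_erase _ _ (Finset.mem_univ i)]
      refine add_le_add ?_ (le_of_eq ?_)
      · refine (integral_mono (hint i i) (integrable_const C)
          fun z => (le_abs_self _).trans (hC _)).trans ?_
        simp [Q]
      · rw [Finset.sum_congr rfl (g := fun _ => A)]
        · have : 1 ≤ n := i.pos
          simp [Finset.card_erase_of_mem, this]
        · intro j hj
          have mp := measurePreserving_eval_pair P (Finset.ne_of_mem_erase hj).symm
          simp only [A, Q]
          rw [← mp.map_eq, integral_map mp.aemeasurable hm.aestronglyMeasurable]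
    calc (0 : ℝ) ≤ _ := h0
      _ ≤ ∑ i : Fin n, (C + ((n : ℝ) - 1) * A) := Finset.sum_le_sum fun i _ => hi i
      _ = _ := by simp [mul_add]
  by_contra! hA
  obtain ⟨n, hn⟩ := exists_nat_gt (max 0 (C / (-A) + 1))
  have hn0 : (0 : ℝ) < n := (le_max_left _ _).trans_lt hn
  have h1 : C / (-A) < n - 1 := by linarith [(le_max_right 0 (C / (-A) + 1)).trans_lt hn]
  rw [div_lt_iff₀ (by linarith)] at h1
  nlinarith [key n]

theorem integral_integral_nonneg_of_double_sum_nonneg {X : Type*} [MeasurableSpace X]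
    (μ : Measure X) [IsFiniteMeasure μ] (H : X × X → ℝ) (hm : Measurable H) (C : ℝ)
    (hC : ∀ p, |H p| ≤ C)
    (hpos : ∀ (n : ℕ) (z : Fin n → X), 0 ≤ ∑ i, ∑ j, H (z i, z j)) :
    0 ≤ ∫ x, ∫ y, H (x, y) ∂μ ∂μ := by
  rcases eq_or_ne μ 0 with rfl | hμ
  · simp
  have : NeZero μ := ⟨hμ⟩
  let P : Measure X := (μ Set.univ)⁻¹ • μ
  have hP : IsProbabilityMeasure P := isProbabilityMeasureSMul
  have hμP : μ = μ Set.univ • P := by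
    rw [smul_smul, ENNReal.mul_inv_cancel (by simpa using hμ) (measure_ne_top _ _), one_smul]
  have h := integral_prod_nonneg_of_double_sum_nonneg P H hm C hC hpos
  rw [integral_prod _ (Integrable.of_bound hm.aestronglyMeasurable C
    (Eventually.of_forall hC))] at h
  rw [hμP]
  simp only [integral_smul_measure, smul_eq_mul, integral_const_mul]
  positivity

theorem IsReproducingKernel.double_sum_nonneg {E : Type*} {k : E → E → ℝ}
    (hk : IsReproducingKernel k) {n : ℕ} (z : Fin n → E) (c : Fin n → ℝ) :
    0 ≤ ∑ i, ∑ j, k (z i) (z j) * (c i * c j) := by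
  have h := (hk n z).dotProduct_mulVec_nonneg c
  simp only [dotProduct, Matrix.mulVec, Finset.mul_sum, Matrix.of_apply, star_trivial] at h
  refine h.trans_eq (Finset.sum_congr rfl fun i _ => Finset.sum_congr rfl fun j _ => ?_)
  ring

theorem IsReproducingKernel.symm {E : Type*} {k : E → E → ℝ} (hk : IsReproducingKernel k)
    (x y : E) : k x y = k y x := by
  simpa using (hk 2 ![x, y]).1.apply 1 0

theorem IsReproducingKernel.abs_le {E : Type*} {k : E → E → ℝ} (hk : IsReproducingKernel k)
    (x y : E) : |k x y| ≤ (k x x + k y y) / 2 := by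
  have h1 := hk.double_sum_nonneg ![x, y] ![1, 1]
  have h2 := hk.double_sum_nonneg ![x, y] ![1, -1]
  simp [Fin.sum_univ_two, hk.symm y x] at h1 h2
  rw [_root_.abs_le]
  constructor <;> linarith

theorem isReproducingKernel_of_double_sum_nonneg {E : Type*} {k : E → E → ℝ}
    (hs : ∀ x y, k x y = k y x)
    (h : ∀ (n : ℕ) (z : Fin n → E) (c : Fin n → ℝ),
      0 ≤ ∑ i, ∑ j, k (z i) (z j) * (c i * c j)) :
    IsReproducingKernel k := by
  intro n z
  refine Matrix.PosSemidef.of_dotProduct_mulVec_nonneg ?_ fun c => ?_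
  · ext i j
    exact hs _ _
  · refine (h n z c).trans_eq ?_
    simp only [dotProduct, Matrix.mulVec, Finset.mul_sum, Matrix.of_apply, star_trivial]
    refine Finset.sum_congr rfl fun i _ => Finset.sum_congr rfl fun j _ => ?_
    ring

/-- The modulus of `h` is absorbed into a finite measure, leaving a bounded phase `u`. The double
sums then split into two real quadratic forms, in the real and imaginary parts of `u`. -/
theorem IsReproducingKernel.integral_integral_nonneg {E : Type*} [MeasurableSpace E]
    {k : E → E → ℝ} (hk : IsReproducingKernel k) (hkm : Measurable (Function.uncurry k))
    {C : ℝ} (hC : ∀ x, k x x ≤ C) {μ : Measure E} {h : E → ℂ} (hm : Measurable h)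
    (hh : Integrable h μ) :
    0 ≤ ∫ x, ∫ y, k x y * (h x * starRingEnd ℂ (h y)).re ∂μ ∂μ := by
  let u : E → ℂ := fun x => h x / (‖h x‖ : ℂ)
  have hu : Measurable u := by fun_prop
  have hu1 : ∀ x, ‖u x‖ ≤ 1 := fun x => by
    simpa [u] using div_self_le_one ‖h x‖
  let ν : Measure E := μ.withDensity fun x => (‖h x‖₊ : NNReal)
  have hν : IsFiniteMeasure ν := isFiniteMeasure_withDensity hh.2.ne
  let H : E × E → ℝ := fun p => k p.1 p.2 * (u p.1 * starRingEnd ℂ (u p.2)).re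
  have hre : ∀ a b : ℂ, (a * starRingEnd ℂ b).re = a.re * b.re + a.im * b.im := by
    intro a b; simp
  have hH := integral_integral_nonneg_of_double_sum_nonneg ν H
    (hkm.mul (Complex.measurable_re.comp
      ((hu.comp measurable_fst).mul
        (Complex.continuous_conj.measurable.comp (hu.comp measurable_snd))))) C ?_ ?_
  · simp only [ν] at hH
    simp_rw [integral_withDensity_eq_integral_smul hm.nnnorm] at hH
    simp only [NNReal.smul_def, coe_nnnorm, smul_eq_mul, ← integral_const_mul] at hH
    refine hH.trans_eq (integral_congr_ae (Eventually.of_forall fun x =>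
      integral_congr_ae (Eventually.of_forall fun y => ?_)))
    simp only [H, u, hre]
    have e : ∀ z : ℂ, z.re = ‖z‖ * (z / (‖z‖ : ℂ)).re ∧ z.im = ‖z‖ * (z / (‖z‖ : ℂ)).im := by
      intro z
      rcases eq_or_ne z 0 with rfl | hz
      · simp
      have hz' : ‖z‖ ≠ 0 := by simpa using hz
      rw [Complex.div_ofReal_re, Complex.div_ofReal_im]
      constructor <;> field_simp
    conv_rhs => rw [(e (h x)).1, (e (h x)).2, (e (h y)).1, (e (h y)).2]
    ring
  · rintro ⟨x, y⟩
    simp only [H, abs_mul]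
    have h1 : |(u x * starRingEnd ℂ (u y)).re| ≤ 1 :=
      (Complex.abs_re_le_norm _).trans (by
        rw [norm_mul, RCLike.norm_conj]
        exact mul_le_one₀ (hu1 x) (norm_nonneg _) (hu1 y))
    have h2 : |k x y| ≤ C := (hk.abs_le x y).trans (by linarith [hC x, hC y])
    calc |k x y| * _ ≤ C * 1 := mul_le_mul h2 h1 (abs_nonneg _) ((abs_nonneg _).trans h2)
      _ = C := mul_one C
  · intro n z
    have h1 := hk.double_sum_nonneg z fun i => (u (z i)).re
    have h2 := hk.double_sum_nonneg z fun i => (u (z i)).im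
    refine (add_nonneg h1 h2).trans_eq ?_
    simp only [H, hre, mul_add, Finset.sum_add_distrib]

/-! ### From squares of test functions to nonnegativity almost everywhere. -/

section
open scoped ContDiff
variable {V : Type*} [NormedAddCommGroup V] [InnerProductSpace ℝ V] [FiniteDimensional ℝ V]
  [MeasurableSpace V] [BorelSpace V]

/-- If a locally integrable real function has nonnegative integrals against squares of test
functions, then it has nonnegative integrals against nonnegative test functions. -/
theorem integral_mul_nonneg_of_integral_mul_sq_nonneg {f : V → ℝ} (hf : LocallyIntegrable f)
    (h : ∀ φ : V → ℝ, ContDiff ℝ ∞ φ → HasCompactSupport φ → 0 ≤ ∫ x, f x * φ x ^ 2)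
    {φ : V → ℝ} (hφ : ContDiff ℝ ∞ φ) (hφc : HasCompactSupport φ) (hφ0 : ∀ x, 0 ≤ φ x) :
    0 ≤ ∫ x, f x * φ x := by
  obtain ⟨R, hR0, hR⟩ : ∃ R : ℝ, 0 < R ∧ tsupport φ ⊆ Metric.closedBall 0 R := by
    obtain ⟨R, hR⟩ := hφc.isCompact.isBounded.subset_closedBall 0
    exact ⟨max R 1, by positivity, hR.trans (Metric.closedBall_subset_closedBall (le_max_left _ _))⟩
  let χ : ContDiffBump (0 : V) := ⟨R, R + 1, hR0, by linarith⟩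
  have hint : ∀ ψ : V → ℝ, Continuous ψ → HasCompactSupport ψ → Integrable fun x => f x * ψ x := by
    intro ψ h1 h2
    simpa [mul_comm] using hf.integrable_smul_left_of_hasCompactSupport h1 h2
  have hχ2 : HasCompactSupport fun x => χ x ^ 2 := by
    simp only [pow_two]
    exact χ.hasCompactSupport.mul_left
  have key : ∀ ε : ℝ, 0 < ε → 0 ≤ (∫ x, f x * φ x) + ε * ∫ x, f x * χ x ^ 2 := by
    intro ε hε
    -- `√φ` need not be smooth: `ε` keeps the root away from zero, and the cutoff `χ`, equal to 1 on
    -- the support of `φ`, restores compact support.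
    have h1 := h (fun x => χ x * √(φ x + ε))
      (χ.contDiff.mul ((hφ.add contDiff_const).sqrt fun x => by have := hφ0 x; positivity))
      χ.hasCompactSupport.mul_right
    refine h1.trans_eq ?_
    rw [← integral_const_mul, ← integral_add (hint φ hφ.continuous hφc)
      ((hint (fun x => χ x ^ 2) (χ.continuous.pow 2) hχ2).const_mul ε)]
    refine integral_congr_ae (Eventually.of_forall fun x => ?_)
    have hx : χ x ^ 2 * φ x = φ x := by
      by_cases hx : φ x = 0
      · simp [hx]
      · rw [χ.one_of_mem_closedBall (hR (subset_tsupport _ hx))]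
        simp
    simp only [mul_pow]
    rw [Real.sq_sqrt (by have := hφ0 x; positivity)]
    linear_combination f x * hx
  have hlim : Tendsto (fun ε : ℝ => (∫ x, f x * φ x) + ε * ∫ x, f x * χ x ^ 2) (𝓝[>] 0)
      (𝓝 ((∫ x, f x * φ x) + 0 * ∫ x, f x * χ x ^ 2)) :=
    (Continuous.tendsto (by fun_prop) 0).mono_left nhdsWithin_le_nhds
  simpa using ge_of_tendsto hlim (eventually_mem_nhdsWithin.mono key)

/-- Averages of `f` against shrinking normalized bumps are nonnegative and converge to `f` almost
everywhere. -/
theorem ae_nonneg_of_integral_mul_sq_nonneg {f : V → ℝ} (hf : LocallyIntegrable f)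
    (h : ∀ φ : V → ℝ, ContDiff ℝ ∞ φ → HasCompactSupport φ → 0 ≤ ∫ x, f x * φ x ^ 2) :
    ∀ᵐ x, 0 ≤ f x := by
  let φ : ℕ → ContDiffBump (0 : V) := fun n =>
    ⟨1 / ((n : ℝ) + 1) / 2, 1 / ((n : ℝ) + 1), by positivity, half_lt_self (by positivity)⟩
  have hlim := ContDiffBump.ae_convolution_tendsto_right_of_locallyIntegrable (μ := volume)
    (φ := φ) (l := atTop) (K := 2) tendsto_one_div_add_atTop_nhds_zero_nat
    (Eventually.of_forall fun n => by simp only [φ]; linarith) hf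
  filter_upwards [hlim] with x hx
  refine ge_of_tendsto hx (Eventually.of_forall fun n => ?_)
  rw [convolution_def, ← integral_sub_left_eq_self _ volume x]
  have := integral_mul_nonneg_of_integral_mul_sq_nonneg hf h
    (φ := fun y => (φ n).normed volume (x - y)) ((φ n).contDiff_normed.comp (by fun_prop))
    ((φ n).hasCompactSupport_normed.comp_homeomorph (Homeomorph.subLeft x))
    fun y => (φ n).nonneg_normed _
  refine this.trans_eq (integral_congr_ae (Eventually.of_forall fun y => ?_))
  simp [mul_comm]
end

/-! ### Weak Fourier transforms of even positive definite functions. -/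

section
open scoped ContDiff FourierTransform
variable {V : Type*} [NormedAddCommGroup V] [InnerProductSpace ℝ V]

/-- A real test function, regarded as a complex-valued Schwartz function. -/
noncomputable def HasCompactSupport.toComplexSchwartzMap {φ : V → ℝ} (hφ : HasCompactSupport φ)
    (hφs : ContDiff ℝ ∞ φ) : 𝓢(V, ℂ) :=
  HasCompactSupport.toSchwartzMap (f := fun x => (φ x : ℂ)) (hφ.comp_left Complex.ofReal_zero)
    (Complex.ofRealCLM.contDiff.comp hφs)

@[simp]
theorem HasCompactSupport.toComplexSchwartzMap_apply {φ : V → ℝ} (hφ : HasCompactSupport φ)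
    (hφs : ContDiff ℝ ∞ φ) (x : V) : hφ.toComplexSchwartzMap hφs x = φ x := rfl

variable [FiniteDimensional ℝ V] [MeasurableSpace V] [BorelSpace V]

theorem fourier_comp_neg (f : V → ℂ) (ξ : V) : 𝓕 (fun x => f (-x)) ξ = 𝓕 f (-ξ) := by
  rw [Real.fourier_eq, Real.fourier_eq, ← integral_neg_eq_self]
  simp

theorem conj_fourier (f : V → ℂ) (ξ : V) :
    starRingEnd ℂ (𝓕 f ξ) = 𝓕 (fun x => starRingEnd ℂ (f x)) (-ξ) := by
  rw [Real.fourier_eq, Real.fourier_eq, ← integral_conj]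
  refine integral_congr_ae (Eventually.of_forall fun x => ?_)
  simp [Circle.smul_def, AddChar.map_neg_eq_inv]

theorem conj_fourier_of_real {f : V → ℂ} (hf : ∀ x, starRingEnd ℂ (f x) = f x) (ξ : V) :
    starRingEnd ℂ (𝓕 f ξ) = 𝓕 f (-ξ) := by
  rw [conj_fourier, funext hf]

theorem fourier_comp_inv_smul (f : V → ℂ) {c : ℝ} (hc : 0 < c) (ξ : V) :
    𝓕 (fun x => f (c⁻¹ • x)) ξ = (c ^ Module.finrank ℝ V : ℝ) • 𝓕 f (c • ξ) := by
  rw [Real.fourier_eq, Real.fourier_eq]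
  have := Measure.integral_comp_inv_smul (volume : Measure V)
    (fun y => Real.fourierChar (-inner ℝ y (c • ξ)) • f y) c
  rw [abs_of_pos (by positivity)] at this
  rw [← this]
  refine integral_congr_ae (Eventually.of_forall fun x => ?_)
  simp [inner_smul_left, inner_smul_right, hc.ne']

theorem integral_norm_fourier_comp_inv_smul (f : V → ℂ) {c : ℝ} (hc : 0 < c) :
    ∫ ξ, ‖𝓕 (fun x => f (c⁻¹ • x)) ξ‖ = ∫ ξ, ‖𝓕 f ξ‖ := by
  simp_rw [fourier_comp_inv_smul f hc, norm_smul, integral_const_mul]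
  rw [Measure.integral_comp_smul volume (fun ξ => ‖𝓕 f ξ‖) c]
  have : c ^ Module.finrank ℝ V ≠ 0 := by positivity
  rw [Real.norm_of_nonneg (by positivity), abs_of_pos (by positivity), smul_eq_mul,
    mul_inv_cancel_left₀ this]

/-- `g` is the Fourier transform of `κ` in the sense of tempered distributions, tested against
Schwartz functions. -/
structure IsWeakFourierTransform (κ : V → ℝ) (g : V → ℂ) : Prop where
  integrable : ∀ γ : 𝓢(V, ℂ), Integrable fun η => g η * γ η
  integral_eq : ∀ γ : 𝓢(V, ℂ), ∫ x, (κ x : ℂ) * 𝓕 γ x = ∫ η, g η * γ η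

namespace IsWeakFourierTransform

variable {κ : V → ℝ} {g : V → ℂ}

theorem locallyIntegrable (h : IsWeakFourierTransform κ g) : LocallyIntegrable g := by
  intro x
  let χ : ContDiffBump x := ⟨1, 2, by norm_num, by norm_num⟩
  refine ⟨Metric.ball x 1, Metric.ball_mem_nhds x one_pos, ?_⟩
  refine ((h.integrable (χ.hasCompactSupport.toComplexSchwartzMap χ.contDiff)).integrableOn
    (s := Metric.ball x 1)).congr_fun (fun y hy => ?_) measurableSet_ball
  simp [χ.one_of_mem_closedBall (Metric.ball_subset_closedBall hy)]

/-- For a real test function, conjugating its transform amounts to reflecting it, which the even `κ`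
does not see; so the pairing with `g` is real. -/
theorem ae_im_eq_zero (h : IsWeakFourierTransform κ g) (hκ : ∀ x, κ (-x) = κ x) :
    ∀ᵐ η, (g η).im = 0 := by
  have hloc : LocallyIntegrable fun η => (g η).im := fun x => by
    obtain ⟨s, hs, hi⟩ := h.locallyIntegrable x
    exact ⟨s, hs, Integrable.im hi⟩
  refine ae_eq_zero_of_integral_contDiff_smul_eq_zero hloc fun φ hφ hφc => ?_
  let γ := hφc.toComplexSchwartzMap hφ
  have h1 : starRingEnd ℂ (∫ η, g η * γ η) = ∫ η, g η * γ η := by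
    rw [← h.integral_eq, ← integral_conj, ← integral_neg_eq_self]
    refine integral_congr_ae (Eventually.of_forall fun x => ?_)
    simp only [map_mul, Complex.conj_ofReal, hκ]
    rw [SchwartzMap.fourier_coe, conj_fourier_of_real (fun x => by simp [γ]), neg_neg]
  have h2 : (∫ η, g η * γ η).im = 0 := Complex.conj_eq_iff_im.1 h1
  rw [← RCLike.im_eq_complex_im, ← integral_im (h.integrable γ)] at h2
  simpa [γ, mul_comm] using h2

/-- Combined with uniqueness (`ae_eq`), this makes `g` even almost everywhere. -/
theorem comp_neg (h : IsWeakFourierTransform κ g) (hκ : ∀ x, κ (-x) = κ x) :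
    IsWeakFourierTransform κ fun η => g (-η) := by
  let r : 𝓢(V, ℂ) → 𝓢(V, ℂ) :=
    SchwartzMap.compCLMOfContinuousLinearEquiv ℂ (LinearIsometryEquiv.neg ℝ (E := V))
  have hr : ∀ γ x, r γ x = γ (-x) := fun γ x => rfl
  refine ⟨fun γ => ?_, fun γ => ?_⟩
  · simpa [hr] using (h.integrable (r γ)).comp_neg
  · have h1 := h.integral_eq (r γ)
    rw [← integral_neg_eq_self, ← integral_neg_eq_self (fun η => g η * r γ η)] at h1
    simp only [hκ, hr, neg_neg, SchwartzMap.fourier_coe] at h1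
    rw [← h1]
    refine integral_congr_ae (Eventually.of_forall fun x => ?_)
    simp only [SchwartzMap.fourier_coe]
    rw [show (r γ : V → ℂ) = fun x => γ (-x) from rfl, fourier_comp_neg, neg_neg]

theorem ae_eq {g' : V → ℂ} (h : IsWeakFourierTransform κ g) (h' : IsWeakFourierTransform κ g') :
    ∀ᵐ η, g η = g' η := by
  refine ae_eq_of_integral_contDiff_smul_eq h.locallyIntegrable h'.locallyIntegrable
    fun φ hφ hφc => ?_
  have h1 := (h.integral_eq (hφc.toComplexSchwartzMap hφ)).symm.trans (h'.integral_eq _)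
  simpa [mul_comm] using h1

theorem re_integral_mul_sq_nonneg (h : IsWeakFourierTransform κ g) (hκc : Continuous κ)
    (hk : IsReproducingKernel fun x y => κ (x - y)) (γ : 𝓢(V, ℂ))
    (hγ : ∀ x, starRingEnd ℂ (γ x) = γ x) : 0 ≤ (∫ η, g η * γ η ^ 2).re := by
  set u : 𝓢(V, ℂ) := 𝓕 γ
  have hbd : ∀ x, ‖(κ x : ℂ)‖ ≤ κ 0 := fun x => by
    simpa using hk.abs_le x 0
  have hu : ∀ x, starRingEnd ℂ (u x) = u (-x) := conj_fourier_of_real hγ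
  let B := ContinuousLinearMap.mul ℂ ℂ
  -- This test function is `γ²`, and its transform is `u * u`.
  have hC := h.integral_eq (𝓕⁻ (SchwartzMap.convolution B u u))
  have hγ2 : ∀ η, 𝓕⁻ (SchwartzMap.convolution B u u) η = γ η ^ 2 := by
    intro η
    have e : 𝓕 u (-η) = γ η := by
      rw [SchwartzMap.fourier_coe, ← Real.fourierInv_eq_fourier_neg, ← SchwartzMap.fourierInv_coe]
      simp [u]
    rw [SchwartzMap.fourierInv_coe, Real.fourierInv_eq_fourier_neg, ← SchwartzMap.fourier_coe,
      SchwartzMap.fourier_convolution, SchwartzMap.pairing_apply_apply, e]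
    simp [B, pow_two]
  simp only [hγ2, FourierTransform.fourier_fourierInv_eq, SchwartzMap.convolution_apply] at hC
  rw [← hC]
  have hF : Integrable (fun p : V × V => (κ (p.1 - p.2) : ℂ) * (u p.1 * starRingEnd ℂ (u p.2)))
      (volume.prod volume) := by
    refine Integrable.bdd_mul (c := κ 0) ?_ (by fun_prop) (Eventually.of_forall fun p => hbd _)
    exact Integrable.mul_prod u.integrable
      ((LinearIsometryEquiv.integrable_comp_iff Complex.conjLIE).2 u.integrable)
  have hG : Integrable (fun p : V × V => (κ p.1 : ℂ) * (u p.2 * u (p.1 - p.2)))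
      (volume.prod volume) :=
    Integrable.bdd_mul (c := κ 0) (u.integrable.convolution_integrand B u.integrable)
      (by fun_prop) (Eventually.of_forall fun p => hbd _)
  have e1 : ∫ x, (κ x : ℂ) * convolution u u B volume x
      = ∫ x, ∫ y, (κ (x - y) : ℂ) * (u x * starRingEnd ℂ (u y)) := by
    simp only [convolution_def, ← integral_const_mul]
    rw [integral_integral_swap hG]
    refine integral_congr_ae (Eventually.of_forall fun t => ?_)
    simp only
    -- Substituting `t - y` turns the second factor into `u (-y)`, the conjugate of `u y` since `γ`
    -- is real.
    rw [← integral_sub_left_eq_self _ volume t]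
    refine integral_congr_ae (Eventually.of_forall fun y => ?_)
    simp [B, hu]
  rw [e1, ← RCLike.re_eq_complex_re, ← integral_re hF.integral_prod_left]
  refine (hk.integral_integral_nonneg (C := κ 0) (by fun_prop) (by simp)
    u.continuous.measurable u.integrable (μ := volume)).trans_eq ?_
  refine integral_congr_ae ?_
  filter_upwards [hF.prod_right_ae] with x hx
  rw [← integral_re hx]
  simp

theorem ae_re_nonneg (h : IsWeakFourierTransform κ g) (hκc : Continuous κ)
    (hk : IsReproducingKernel fun x y => κ (x - y)) : ∀ᵐ η, 0 ≤ (g η).re := by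
  have hloc : LocallyIntegrable fun η => (g η).re := fun x => by
    obtain ⟨s, hs, hi⟩ := h.locallyIntegrable x
    exact ⟨s, hs, Integrable.re hi⟩
  refine ae_nonneg_of_integral_mul_sq_nonneg hloc fun φ hφ hφc => ?_
  let γ := hφc.toComplexSchwartzMap hφ
  have h1 := h.re_integral_mul_sq_nonneg hκc hk γ fun x => by simp [γ]
  have h2 : Integrable fun η => g η * γ η ^ 2 := by
    simpa [SchwartzMap.pairing_apply_apply, pow_two] using
      h.integrable (SchwartzMap.pairing (ContinuousLinearMap.mul ℂ ℂ) γ γ)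
  rw [← RCLike.re_eq_complex_re, ← integral_re h2] at h1
  refine h1.trans_eq (integral_congr_ae (Eventually.of_forall fun x => ?_))
  simp only [γ, HasCompactSupport.toComplexSchwartzMap_apply, ← Complex.ofReal_pow]
  exact Complex.re_mul_ofReal _ _

/-- Since `g ≥ 0`, its mass on a ball is at most its pairing with a bump equal to 1 there. That
pairing is at most `κ 0` times the L¹ norm of the bump's transform, which dilation does not change.
-/
theorem integrable_of_kernel (h : IsWeakFourierTransform κ g) (hκc : Continuous κ)
    (hk : IsReproducingKernel fun x y => κ (x - y)) (hκ : ∀ x, κ (-x) = κ x) :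
    Integrable g := by
  have hbd : ∀ x, ‖(κ x : ℂ)‖ ≤ κ 0 := fun x => by
    simpa using hk.abs_le x 0
  let χ : ContDiffBump (0 : V) := ⟨1, 2, by norm_num, by norm_num⟩
  have hr : Tendsto (fun n : ℕ => (n : ℝ) + 1) atTop atTop :=
    tendsto_atTop_add_const_right _ _ tendsto_natCast_atTop_atTop
  refine (aecover_ball (μ := volume) (x := (0 : V)) hr).integrable_of_integral_norm_bounded
    (κ 0 * ∫ ξ, ‖𝓕 (fun x => (χ x : ℂ)) ξ‖)
    (fun n => (h.locallyIntegrable.integrableOn_isCompact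
      (isCompact_closedBall 0 _)).mono_set Metric.ball_subset_closedBall)
    (Eventually.of_forall fun n => ?_)
  have hn : (0 : ℝ) < n + 1 := by positivity
  let γ : 𝓢(V, ℂ) := HasCompactSupport.toComplexSchwartzMap
    (φ := fun x => χ (((n : ℝ) + 1)⁻¹ • x)) (χ.hasCompactSupport.comp_smul (inv_ne_zero hn.ne'))
    (χ.contDiff.comp (contDiff_const_smul _))
  have hγ : ∀ x, γ x = χ (((n : ℝ) + 1)⁻¹ • x) := fun x => rfl
  have hint := (h.integrable γ).norm
  have hnonneg := h.ae_re_nonneg hκc hk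
  have him := h.ae_im_eq_zero hκ
  calc ∫ x in Metric.ball 0 ((n : ℝ) + 1), ‖g x‖
      = ∫ x in Metric.ball 0 ((n : ℝ) + 1), ‖g x * γ x‖ := by
        refine setIntegral_congr_fun measurableSet_ball fun x hx => ?_
        have : χ (((n : ℝ) + 1)⁻¹ • x) = 1 := by
          apply χ.one_of_mem_closedBall
          rw [mem_closedBall_zero_iff, norm_smul, norm_inv, Real.norm_of_nonneg hn.le]
          rw [mem_ball_zero_iff] at hx
          exact (inv_mul_le_one₀ hn).2 hx.le
        simp [hγ, this]
    _ ≤ ∫ x, ‖g x * γ x‖ := setIntegral_le_integral hint (Eventually.of_forall fun x => norm_nonneg _)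
    _ = ∫ x, (g x * γ x).re := by
        refine integral_congr_ae ?_
        filter_upwards [hnonneg, him] with x h1 h2
        have : g x = ((g x).re : ℂ) := Complex.ext rfl (by simp [h2])
        rw [this, hγ, ← Complex.ofReal_mul, Complex.ofReal_re, Complex.norm_real,
          Real.norm_of_nonneg (mul_nonneg h1 χ.nonneg)]
    _ = (∫ x, g x * γ x).re := integral_re (h.integrable γ)
    _ ≤ ‖∫ x, g x * γ x‖ := Complex.re_le_norm _
    _ = ‖∫ x, (κ x : ℂ) * 𝓕 γ x‖ := by rw [h.integral_eq]
    _ ≤ ∫ x, κ 0 * ‖𝓕 γ x‖ := by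
        refine norm_integral_le_of_norm_le ((𝓕 γ).integrable.norm.const_mul _)
          (Eventually.of_forall fun x => ?_)
        rw [norm_mul]
        exact mul_le_mul_of_nonneg_right (hbd x) (norm_nonneg _)
    _ = _ := by
        rw [integral_const_mul, SchwartzMap.fourier_coe,
          ← integral_norm_fourier_comp_inv_smul (fun x => (χ x : ℂ)) hn]
        rfl

theorem integral_fourier_mul {f : V → ℂ} (hf : Integrable f) (γ : 𝓢(V, ℂ)) :
    ∫ ξ, 𝓕 f ξ * γ ξ = ∫ x, f x * 𝓕 γ x := by
  simpa using! VectorFourier.integral_fourierIntegral_smul_eq_flip (L := innerₗ V)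
    Real.continuous_fourierChar continuous_inner hf γ.integrable

/-- Testing the weak identity on `𝓕 γ` and using Fourier inversion gives equality a.e.; continuity
of both sides upgrades it to every point. -/
theorem fourier_eq (h : IsWeakFourierTransform κ g) (hκc : Continuous κ)
    (hκ : ∀ x, κ (-x) = κ x) (hg : Integrable g) (x : V) : 𝓕 g x = κ x := by
  have hcont : Continuous (𝓕 g) := VectorFourier.fourierIntegral_continuous
    Real.continuous_fourierChar (L := innerₗ V) continuous_inner hg
  have hae : ∀ᵐ x, 𝓕 g x = (κ x : ℂ) := by
    refine ae_eq_of_integral_contDiff_smul_eq hcont.locallyIntegrable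
      (by fun_prop : Continuous fun x => (κ x : ℂ)).locallyIntegrable fun φ hφ hφc => ?_
    let γ := hφc.toComplexSchwartzMap hφ
    have h1 := h.integral_eq (𝓕 γ)
    rw [← integral_fourier_mul hg, ← integral_neg_eq_self] at h1
    have e : ∀ x, 𝓕 (𝓕 γ) (-x) = γ x := fun x => by
      rw [SchwartzMap.fourier_coe, ← Real.fourierInv_eq_fourier_neg, ← SchwartzMap.fourierInv_coe]
      simp
    simp only [e, hκ] at h1
    simpa [γ, mul_comm] using h1.symm
  exact congrFun (Continuous.ae_eq_iff_eq volume hcont (by fun_prop) |>.1 hae) x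

end IsWeakFourierTransform
end

/-! ### Plancherel and the convolution identity on L¹ ∩ L². -/

section
open scoped ContDiff FourierTransform
variable {V : Type*} [NormedAddCommGroup V] [InnerProductSpace ℝ V]
  [FiniteDimensional ℝ V] [MeasurableSpace V] [BorelSpace V]

theorem continuous_fourier {f : V → ℂ} (hf : Integrable f) : Continuous (𝓕 f) :=
  VectorFourier.fourierIntegral_continuous Real.continuous_fourierChar (L := innerₗ V)
    continuous_inner hf

theorem fourier_congr_ae {f g : V → ℂ} (h : f =ᵐ[volume] g) : 𝓕 f = 𝓕 g := by
  ext ξ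
  rw [Real.fourier_eq, Real.fourier_eq]
  refine integral_congr_ae ?_
  filter_upwards [h] with x hx
  rw [hx]

theorem fourier_modulate (f : V → ℂ) (x ξ : V) :
    𝓕 (fun η => (Real.fourierChar (inner ℝ η x) : ℂ) * f η) ξ = 𝓕 f (ξ - x) := by
  rw [Real.fourier_eq, Real.fourier_eq]
  refine integral_congr_ae (Eventually.of_forall fun η => ?_)
  simp only [Circle.smul_def, smul_eq_mul, sub_eq_add_neg, inner_add_right, inner_neg_right, neg_add,
    AddChar.map_add_eq_mul, Circle.coe_mul, neg_neg]
  ring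

/-- On `L¹ ∩ L²`, the `L²` Fourier transform is given by the Fourier integral. -/
theorem fourier_toLp_ae_eq {f : V → ℂ} (hf : Integrable f) (hf2 : MemLp f 2) :
    (𝓕 (hf2.toLp f) : Lp ℂ 2 (volume : Measure V)) =ᵐ[volume] 𝓕 f := by
  have hloc : LocallyIntegrable ⇑(𝓕 (hf2.toLp f) : Lp ℂ 2 (volume : Measure V)) :=
    (Lp.memLp _).locallyIntegrable (by norm_num)
  refine ae_eq_of_integral_contDiff_smul_eq hloc (continuous_fourier hf).locallyIntegrable
    fun φ hφ hφc => ?_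
  let γ := hφc.toComplexSchwartzMap hφ
  -- Both transforms obey the same duality formula against test functions, so they agree as
  -- distributions.
  have h1 := DFunLike.congr_fun (Lp.fourier_toTemperedDistribution_eq (hf2.toLp f)) γ
  rw [TemperedDistribution.fourier_apply, Lp.toTemperedDistribution_apply,
    Lp.toTemperedDistribution_apply] at h1
  have h2 : ∫ x, 𝓕 γ x • hf2.toLp f x = ∫ x, f x * 𝓕 γ x := by
    refine integral_congr_ae ?_
    filter_upwards [hf2.coeFn_toLp] with x hx
    rw [hx, smul_eq_mul, mul_comm]
  rw [h2, ← IsWeakFourierTransform.integral_fourier_mul hf] at h1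
  simpa [γ, mul_comm] using h1.symm

theorem memLp_fourier {f : V → ℂ} (hf : Integrable f) (hf2 : MemLp f 2) : MemLp (𝓕 f) 2 :=
  (memLp_congr_ae (fourier_toLp_ae_eq hf hf2)).1 (Lp.memLp _)

theorem integral_conj_fourier_mul_fourier {f g : V → ℂ} (hf : Integrable f) (hf2 : MemLp f 2)
    (hg : Integrable g) (hg2 : MemLp g 2) :
    ∫ ξ, starRingEnd ℂ (𝓕 f ξ) * 𝓕 g ξ = ∫ x, starRingEnd ℂ (f x) * g x := by
  have h := Lp.inner_fourier_eq (hf2.toLp f) (hg2.toLp g)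
  rw [L2.inner_def, L2.inner_def] at h
  calc _ = _ := integral_congr_ae ?_
    _ = _ := h
    _ = _ := integral_congr_ae ?_
  · filter_upwards [fourier_toLp_ae_eq hf hf2, fourier_toLp_ae_eq hg hg2] with x h1 h2
    rw [h1, h2, RCLike.inner_apply, mul_comm]
  · filter_upwards [hf2.coeFn_toLp, hg2.coeFn_toLp] with x h1 h2
    rw [h1, h2, RCLike.inner_apply, mul_comm]

variable {σ : V → ℝ}

theorem fourier_neg_of_even (he : ∀ᵐ η, σ (-η) = σ η) (x : V) :
    𝓕 (fun η => (σ η : ℂ)) (-x) = 𝓕 (fun η => (σ η : ℂ)) x := by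
  rw [← fourier_comp_neg]
  refine congrFun (fourier_congr_ae ?_) x
  filter_upwards [he] with η hη
  rw [hη]

theorem ofReal_re_fourier_of_even (he : ∀ᵐ η, σ (-η) = σ η) (x : V) :
    ((𝓕 (fun η => (σ η : ℂ)) x).re : ℂ) = 𝓕 (fun η => (σ η : ℂ)) x := by
  rw [← Complex.conj_eq_iff_re, conj_fourier_of_real (fun _ => Complex.conj_ofReal _),
    fourier_neg_of_even he]

/-- The convolution identity for the Fourier transform of an even real function in
`L¹ ∩ L²`. -/
theorem integral_fourier_sub_mul_fourier_sub (h1 : Integrable σ) (h2 : MemLp σ 2)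
    (he : ∀ᵐ η, σ (-η) = σ η) (x y : V) :
    Integrable (fun z => 𝓕 (fun η => (σ η : ℂ)) (x - z) * 𝓕 (fun η => (σ η : ℂ)) (y - z)) ∧
    ∫ z, 𝓕 (fun η => (σ η : ℂ)) (x - z) * 𝓕 (fun η => (σ η : ℂ)) (y - z) =
      𝓕 (fun η => ((σ η ^ 2 : ℝ) : ℂ)) (x - y) := by
  -- Modulation by `x` translates the transform; evenness of `σ` then gives the form `x - z` and
  -- makes the transform real, so the conjugate in Plancherel disappears.
  let m : V → V → ℂ := fun x η => (Real.fourierChar (inner ℝ η x) : ℂ) * σ η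
  have hmm : ∀ x, AEStronglyMeasurable (m x) := fun x =>
    (Continuous.aestronglyMeasurable (continuous_subtype_val.comp
      (Real.continuous_fourierChar.comp (by fun_prop)))).mul h1.ofReal.aestronglyMeasurable
  have hn : ∀ x η, ‖m x η‖ = ‖σ η‖ := fun x η => by
    simp [m, Circle.norm_coe]
  have hm1 : ∀ x, Integrable (m x) := fun x => h1.congr' (hmm x) (by simp [hn])
  have hm2 : ∀ x, MemLp (m x) 2 := fun x => h2.congr_norm (hmm x) (by simp [hn])
  have hF : ∀ x z, 𝓕 (m x) z = 𝓕 (fun η => (σ η : ℂ)) (x - z) := fun x z => by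
    rw [fourier_modulate, ← fourier_neg_of_even he, neg_sub]
  have hconj : ∀ x z, starRingEnd ℂ (𝓕 (m x) z) = 𝓕 (m x) z := fun x z => by
    rw [hF, ← ofReal_re_fourier_of_even he, Complex.conj_ofReal]
  simp only [← hF]
  refine ⟨(memLp_fourier (hm1 x) (hm2 x)).integrable_mul (memLp_fourier (hm1 y) (hm2 y)), ?_⟩
  have := integral_conj_fourier_mul_fourier (hm1 x) (hm2 x) (hm1 y) (hm2 y)
  simp only [hconj] at this
  rw [this, Real.fourier_eq]
  refine integral_congr_ae (Eventually.of_forall fun η => ?_)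
  simp only [m, map_mul, Complex.conj_ofReal, ← Circle.coe_inv_eq_conj, ← AddChar.map_neg_eq_inv,
    Circle.smul_def, smul_eq_mul, sub_eq_add_neg, inner_add_right, inner_neg_right, neg_add,
    neg_neg, AddChar.map_add_eq_mul, Circle.coe_mul, Complex.ofReal_pow]
  ring

/-- The quadratic form equals `∫ σ |∑ cᵢ eᵢ|²` with `eᵢ` the character at `zᵢ`. -/
theorem isReproducingKernel_re_fourier (h1 : Integrable σ) (h0 : ∀ η, 0 ≤ σ η)
    (he : ∀ᵐ η, σ (-η) = σ η) :
    IsReproducingKernel fun x y : V => (𝓕 (fun η => (σ η : ℂ)) (x - y)).re := by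
  refine isReproducingKernel_of_double_sum_nonneg (fun x y => ?_) fun n z c => ?_
  · rw [← fourier_neg_of_even he, neg_sub]
  let e : V → V → ℂ := fun x η => (Real.fourierChar (-inner ℝ η x) : ℂ)
  have hint : ∀ x, Integrable fun η => e x η * (σ η : ℂ) := fun x => by
    have h1' : Integrable fun η => (σ η : ℂ) := h1.ofReal
    simpa [e, Circle.smul_def] using (Real.fourierIntegral_convergent_iff (μ := volume) x).2 h1'
  have key : ∑ i, ∑ j, 𝓕 (fun η => (σ η : ℂ)) (z i - z j) * ((c i : ℂ) * c j) =
      ∫ η, ((σ η * Complex.normSq (∑ i, c i * e (z i) η) : ℝ) : ℂ) := by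
    have : ∀ i j, 𝓕 (fun η => (σ η : ℂ)) (z i - z j) * ((c i : ℂ) * c j) =
        ∫ η, e (z i - z j) η * (σ η : ℂ) * ((c i : ℂ) * c j) := fun i j => by
      rw [integral_mul_const, Real.fourier_eq]
      rfl
    simp_rw [this]
    simp_rw [← integral_finsetSum _ fun j _ => (hint _).mul_const _]
    rw [← integral_finsetSum _ fun i _ => integrable_finsetSum _ fun j _ => (hint _).mul_const _]
    refine integral_congr_ae (Eventually.of_forall fun η => ?_)
    simp only [Complex.ofReal_mul, ← Complex.mul_conj, map_sum, map_mul, Complex.conj_ofReal]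
    rw [Finset.sum_mul_sum]
    simp only [Finset.mul_sum]
    refine Finset.sum_congr rfl fun i _ => Finset.sum_congr rfl fun j _ => ?_
    have : e (z i - z j) η = e (z i) η * starRingEnd ℂ (e (z j) η) := by
      simp only [e, ← Circle.coe_inv_eq_conj, ← AddChar.map_neg_eq_inv, ← Circle.coe_mul,
        ← AddChar.map_add_eq_mul, inner_sub_right]
      congr 2
      ring
    rw [this]
    ring
  have hre := congrArg Complex.re key
  rw [integral_complex_ofReal, Complex.ofReal_re] at hre
  refine (integral_nonneg fun η => mul_nonneg (h0 η) (Complex.normSq_nonneg _)).trans_eq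
    (hre.symm.trans ?_)
  simp only [Complex.re_sum, ← Complex.ofReal_mul, Complex.re_mul_ofReal]
end

/-! ### Change of Fourier normalization and conclusion. -/

open scoped FourierTransform

theorem angularFourier_eq {d : ℕ} (f : EuclideanSpace ℝ (Fin d) → ℂ)
    (ξ : EuclideanSpace ℝ (Fin d)) :
    angularFourier f ξ =
      (((2 * Real.pi) ^ (-(d : ℝ) / 2) : ℝ) : ℂ) * 𝓕 f ((2 * Real.pi)⁻¹ • ξ) := by
  rw [angularFourier, Real.fourier_eq']
  congr 1
  refine integral_congr_ae (Eventually.of_forall fun x => ?_)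
  simp only [smul_eq_mul, inner_smul_right]
  rw [mul_comm]
  congr 2
  push_cast
  have : (Real.pi : ℂ) ≠ 0 := by exact_mod_cast Real.pi_ne_zero
  field_simp

theorem IsGeneralizedFourierTransform.isWeakFourierTransform {d : ℕ}
    {κ : EuclideanSpace ℝ (Fin d) → ℝ} {g : EuclideanSpace ℝ (Fin d) → ℂ}
    (h : IsGeneralizedFourierTransform 0 (fun x => (κ x : ℂ)) g) :
    IsWeakFourierTransform (fun y => κ ((2 * Real.pi) • y))
      fun η => (((2 * Real.pi) ^ (-(d : ℝ) / 2) : ℝ) : ℂ) * g η := by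
  -- At order 0 the vanishing condition is mere boundedness near the origin, so every Schwartz
  -- function is admissible.
  have hO : ∀ γ : 𝓢(EuclideanSpace ℝ (Fin d), ℂ),
      (γ : EuclideanSpace ℝ (Fin d) → ℂ) =O[𝓝 0] fun η => ‖η‖ ^ (2 * 0) := fun γ => by
    simpa using (γ.continuous.tendsto 0).isBigO_one ℝ
  have hp : (0 : ℝ) < 2 * Real.pi := by positivity
  set b : ℝ := (2 * Real.pi) ^ (-(d : ℝ) / 2) with hb
  have hbd : b * b * (2 * Real.pi) ^ d = 1 := by
    rw [hb, ← Real.rpow_natCast, ← Real.rpow_add hp, ← Real.rpow_add hp]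
    ring_nf
    simp
  refine ⟨fun γ => by simpa [mul_assoc] using (h.integrable γ (hO γ)).const_mul (b : ℂ),
    fun γ => ?_⟩
  have h1 := h.integral_eq γ (hO γ)
  have h2 := Measure.integral_comp_inv_smul (volume : Measure (EuclideanSpace ℝ (Fin d)))
    (fun y => (κ ((2 * Real.pi) • y) : ℂ) * 𝓕 γ y) (2 * Real.pi)
  simp only [smul_inv_smul₀ hp.ne', finrank_euclideanSpace_fin] at h2
  rw [abs_of_pos (by positivity), Complex.real_smul] at h2
  simp only [mul_assoc, integral_const_mul]
  rw [← h1]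
  simp only [angularFourier_eq, ← hb, mul_left_comm _ (b : ℂ), integral_const_mul]
  rw [SchwartzMap.fourier_coe] at h2 ⊢
  rw [h2, ← mul_assoc, ← mul_assoc, ← Complex.ofReal_mul, ← Complex.ofReal_mul, hbd]
  simp

theorem proposition2 (d : ℕ)
    (k : EuclideanSpace ℝ (Fin d) → EuclideanSpace ℝ (Fin d) → ℝ)
    (hk : IsReproducingKernel k)
    (hkc : Continuous (Function.uncurry k))
    (κ : EuclideanSpace ℝ (Fin d) → ℝ)
    (hκ : ∀ x y, k x y = κ (x - y))
    (κhat : EuclideanSpace ℝ (Fin d) → ℂ)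
    (hκhat : IsGeneralizedFourierTransform 0 (fun x => (κ x : ℂ)) κhat)
    (hsqrt : Integrable fun ω => Complex.sqrt (κhat ω)) :
    (∀ᵐ ω, (κhat ω).im = 0 ∧ 0 ≤ (κhat ω).re) ∧
      ∃ krt : EuclideanSpace ℝ (Fin d) → EuclideanSpace ℝ (Fin d) → ℝ,
        (∀ x y, (krt x y : ℂ) = (((2 * Real.pi) ^ (-(d : ℝ) / 4) : ℝ) : ℂ) *
          angularFourier (fun ω => Complex.sqrt (κhat ω)) (x - y)) ∧
        IsSquareRootKernel krt k := by
  have hp : (0 : ℝ) < 2 * Real.pi := by positivity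
  have hweak := hκhat.isWeakFourierTransform
  set a : ℝ := (2 * Real.pi) ^ (-(d : ℝ) / 4) with ha
  set b : ℝ := (2 * Real.pi) ^ (-(d : ℝ) / 2) with hb
  have ha0 : 0 < a := by positivity
  have hb0 : 0 < b := by positivity
  have hbC : (b : ℂ) ≠ 0 := by exact_mod_cast hb0.ne'
  have hab : a * a = b := by
    rw [ha, hb, ← Real.rpow_add hp]
    congr 1
    ring
  have hbd : b * b * (2 * Real.pi) ^ d = 1 := by
    rw [hb, ← Real.rpow_natCast, ← Real.rpow_add hp, ← Real.rpow_add hp]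
    ring_nf
    simp
  have hκc : Continuous κ := by
    have : κ = fun x => Function.uncurry k (x, 0) := by ext x; simp [hκ]
    rw [this]
    fun_prop
  have hκc' : Continuous fun y => κ ((2 * Real.pi) • y) := by fun_prop
  have hk' : IsReproducingKernel fun x y : EuclideanSpace ℝ (Fin d) =>
      κ ((2 * Real.pi) • (x - y)) := by
    intro l z
    simpa [hκ, smul_sub] using hk l fun i => (2 * Real.pi) • z i
  have heven : ∀ x, κ (-x) = κ x := fun x => by simpa [hκ] using hk.symm 0 x
  have heven' : ∀ x, κ ((2 * Real.pi) • -x) = κ ((2 * Real.pi) • x) := fun x => by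
    rw [smul_neg, heven]
  have him : ∀ᵐ η, (κhat η).im = 0 := by
    filter_upwards [hweak.ae_im_eq_zero heven'] with η hη
    simpa [hb0.ne'] using hη
  have hre : ∀ᵐ η, 0 ≤ (κhat η).re := by
    filter_upwards [hweak.ae_re_nonneg hκc' hk'] with η hη
    rw [Complex.re_ofReal_mul] at hη
    exact nonneg_of_mul_nonneg_right hη hb0
  have hintb := hweak.integrable_of_kernel hκc' hk' heven'
  have hint : Integrable κhat := by
    simpa [hbC] using hintb.const_mul (b : ℂ)⁻¹
  have heven_hat : ∀ᵐ η, κhat (-η) = κhat η := by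
    filter_upwards [(hweak.comp_neg heven').ae_eq hweak] with η hη
    exact mul_left_cancel₀ hbC hη
  let σ : EuclideanSpace ℝ (Fin d) → ℝ := fun η => √(κhat η).re
  have hσs : (fun η => Complex.sqrt (κhat η)) =ᵐ[volume] fun η => (σ η : ℂ) := by
    filter_upwards [him, hre] with η h1 h2
    have : κhat η = ((κhat η).re : ℂ) := Complex.ext rfl (by simp [h1])
    rw [this, Complex.sqrt_of_nonneg (by exact_mod_cast h2)]
    simp [σ]
  have hσ1 : Integrable σ := by
    have := (hsqrt.congr hσs).re
    simpa using this
  have hσ2 : (fun η => ((σ η ^ 2 : ℝ) : ℂ)) =ᵐ[volume] κhat := by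
    filter_upwards [him, hre] with η h1 h2
    exact Complex.ext (by simp only [σ, Real.sq_sqrt h2, Complex.ofReal_re])
      (by rw [Complex.ofReal_im, h1])
  have hσL2 : MemLp σ 2 := by
    rw [memLp_two_iff_integrable_sq hσ1.aestronglyMeasurable]
    exact (hint.congr hσ2.symm).re
  have hσe : ∀ᵐ η, σ (-η) = σ η := by
    filter_upwards [heven_hat] with η hη
    simp only [σ, hη]
  let F : EuclideanSpace ℝ (Fin d) → ℂ := 𝓕 fun η => (σ η : ℂ)
  have hF : ∀ x, ((F x).re : ℂ) = F x := ofReal_re_fourier_of_even hσe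
  let krt : EuclideanSpace ℝ (Fin d) → EuclideanSpace ℝ (Fin d) → ℝ := fun x y =>
    a * b * (F ((2 * Real.pi)⁻¹ • x - (2 * Real.pi)⁻¹ • y)).re
  refine ⟨him.and hre, krt, fun x y => ?_, ?_, fun x y => ?_⟩
  · rw [angularFourier_eq, fourier_congr_ae hσs, smul_sub]
    simp only [krt, Complex.ofReal_mul, hF, mul_assoc]
    rfl
  · have h0 := isReproducingKernel_re_fourier hσ1 (fun η => Real.sqrt_nonneg _) hσe
    intro l z
    exact (h0 l fun i => (2 * Real.pi)⁻¹ • z i).smul (mul_pos ha0 hb0).le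
  · obtain ⟨hI, hE⟩ := integral_fourier_sub_mul_fourier_sub hσ1 hσL2 hσe
      ((2 * Real.pi)⁻¹ • x) ((2 * Real.pi)⁻¹ • y)
    let Φ : EuclideanSpace ℝ (Fin d) → ℝ := fun w =>
      (F ((2 * Real.pi)⁻¹ • x - w)).re * (F ((2 * Real.pi)⁻¹ • y - w)).re
    have hΦ : ∀ w, (Φ w : ℂ) = F ((2 * Real.pi)⁻¹ • x - w) * F ((2 * Real.pi)⁻¹ • y - w) :=
      fun w => by simp only [Φ, Complex.ofReal_mul, hF]
    have hΦi : Integrable Φ := by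
      have : Integrable fun w => (Φ w : ℂ) := by simpa only [hΦ] using hI
      simpa using this.re
    have hkk : ∀ z, krt x z * krt y z = a * b * (a * b) * Φ ((2 * Real.pi)⁻¹ • z) := fun z => by
      simp only [krt, Φ]
      ring
    have hΦe : b * ∫ w, Φ w = κ (x - y) := by
      have h1 := hweak.fourier_eq hκc' heven' hintb ((2 * Real.pi)⁻¹ • (x - y))
      rw [smul_inv_smul₀ hp.ne'] at h1
      have h2 : 𝓕 (fun η => (b : ℂ) * κhat η) ((2 * Real.pi)⁻¹ • (x - y)) =
          b * 𝓕 κhat ((2 * Real.pi)⁻¹ • (x - y)) := by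
        rw [Real.fourier_eq, Real.fourier_eq, ← integral_const_mul]
        refine integral_congr_ae (Eventually.of_forall fun η => ?_)
        simp only [Circle.smul_def, smul_eq_mul]
        ring
      rw [h2, ← fourier_congr_ae hσ2, smul_sub, ← hE] at h1
      have h3 : ∫ w, (Φ w : ℂ) = _ := integral_congr_ae (Eventually.of_forall hΦ)
      rw [← h3, integral_complex_ofReal] at h1
      exact_mod_cast h1
    simp only [hkk]
    refine ⟨(hΦi.comp_smul (inv_ne_zero hp.ne')).const_mul _, ?_⟩
    rw [integral_const_mul, Measure.integral_comp_inv_smul, finrank_euclideanSpace_fin,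
      abs_of_pos (by positivity), smul_eq_mul, hκ, ← hΦe]
    -- The prefactor `(a b)²` times the Jacobian `(2π)^d` collapses to `b`, by `a² = b` and `b²
    -- (2π)^d = 1`.
    linear_combination (-(b * ∫ w, Φ w)) * (b * (2 * Real.pi) ^ d * hab + hbd)
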